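/- Let $\Omega\subset\mathbb{R}^3$ be a bounded open set, $0<T\le\infty$ and $\Omega_T=\Omega\times(0,T)$. Let $S\mapsto\mathbb{H}(S)$ be a Borel measurable map that assigns to every $S\in\mathrm{Sym}(3)$ a linear map $D\mapsto\mathbb{H}(S).D$ of $\mathrm{Sym}(3)$ to itself (a minor symmetric fourth-order stiffness tensor, for example the tensor $\mathbb{H}^{\mathrm{ZJ}}$ induced by a Cauchy-elastic law and the Zaremba–Jaumann rate), and let $\sigma(\cdot,t):\Omega\to\mathrm{Sym}(3)$, $t\in(0,T)$, be given stress fields. $\mathrm{Sym}(3)$ carries the Frobenius inner product, $(\mathrm{D}v)_{ij}=\partial_j v_i$, $\mathrm{sym}\,X=\frac12(X+X^T)$, and $(\mathrm{Div}\,\tau)_i=\sum_j\partial_j\tau_{ij}$ in the sense of distributions. $H^1_0(\Omega;\mathbb{R}^3)$ is the closure of $C_c^\infty(\Omega;\mathbb{R}^3)$ in the $H^1$ norm, and $H^{-1}(\Omega;\mathbb{R}^3)$ is its dual. For $v\in H^1_0(\Omega;\mathbb{R}^3)$ put $$\mathbb{A}(\sigma(\cdot,t)).v:=-\mathrm{Div}\big[\mathbb{H}(\sigma(\cdot,t)).\mathrm{sym}\,\mathrm{D}v\big].$$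 We say that $\mathbb{A}(\sigma(\cdot,t))$ is well defined from $H_0^1$ to $H^{-1}$ if for every $v\in H^1_0(\Omega;\mathbb{R}^3)$ the field $\mathbb{H}(\sigma(\cdot,t)).\mathrm{sym}\,\mathrm{D}v$ is locally integrable in $\Omega$ and the distribution $\mathbb{A}(\sigma(\cdot,t)).v$ belongs to $H^{-1}(\Omega;\mathbb{R}^3)$. For $t\in(0,T)$ consider the conditions (a) $\sigma(\cdot,t)\in H^1(\Omega;\mathrm{Sym}(3))$; (b) there is $c_0>0$ such that for almost every $\xi\in\Omega$: $\langle\mathbb{H}(\sigma(\xi,t)).D,D\rangle\ge c_0\|D\|^2$ for all $D\in\mathrm{Sym}(3)$; (c) $\mathbb{A}(\sigma(\cdot,t))$ is well defined from $H_0^1$ to $H^{-1}$. Then: 1. If (a) holds at $t\in(0,T)$ and $\xi\mapsto\mathbb{H}(\sigma(\xi,t))$ is essentially bounded on $\Omega$, then (c) holds at $t$. 2. If (a), (b), (c) hold at $t\in(0,T)$, then $A:=\mathbb{A}(\sigma(\cdot,t)):H^1_0(\Omega;\mathbb{R}^3)\to H^{-1}(\Omega;\mathbb{R}^3)$ is hemicontinuous,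 i.e. $r\mapsto\langle A((1-r)v_1+rv_2),w\rangle$ is continuous on $[0,1]$ for all $v_1,v_2,w\in H^1_0(\Omega;\mathbb{R}^3)$, and strictly monotone, i.e. $\langle A v_1-A v_2,v_1-v_2\rangle>0$ whenever $v_1\ne v_2$. 3. If $g\in L^2(\Omega_T;\mathbb{R}^3)$, then for almost every $t\in(0,T)$ at which (a), (b), (c) hold, the equation $$-\mathrm{Div}\big[\mathbb{H}(\sigma(\cdot,t)).\mathrm{sym}\,\mathrm{D}v\big]=g(\cdot,t)\quad\text{in }\Omega$$ has exactly one solution $v\in H^1_0(\Omega;\mathbb{R}^3)$ in the sense of distributions. -/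

import Mathlib

open MeasureTheory Set TopologicalSpace
open scoped Distributions ContDiff ENNReal

noncomputable section

namespace RateElasticity

/-- Euclidean three-space. -/
abbrev R3 : Type := EuclideanSpace ℝ (Fin 3)

/-- Second-order tensors, i.e. real `3 × 3` matrices, with the Frobenius inner product and norm;
the entry in row `i` and column `j` of `A` is `A (i, j)`. -/
abbrev Tensor : Type := EuclideanSpace ℝ (Fin 3 × Fin 3)

/-- The space `Sym(3)` of symmetric matrices, with the Frobenius inner product. -/
def Sym3 : Submodule ℝ Tensor where
  carrier := {A | ∀ i j, A (i, j) = A (j, i)}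
  add_mem' := by
    intro A B hA hB i j
    simp [hA i j, hB i j]
  zero_mem' := by
    intro i j
    simp
  smul_mem' := by
    intro c A hA i j
    simp [hA i j]

/-- The symmetric part `sym X = (X + Xᵀ) / 2`. -/
def symPart (X : Tensor) : Sym3 :=
  ⟨WithLp.toLp 2 fun p => (X (p.1, p.2) + X (p.2, p.1)) / 2, by
    intro i j
    change (X (i, j) + X (j, i)) / 2 = (X (j, i) + X (i, j)) / 2
    rw [add_comm]⟩

/-- The Jacobian matrix of a vector field: `(D u)_{ij} = ∂_j u_i`. -/
def jacobian (u : R3 → R3) (x : R3) : Tensor :=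
  WithLp.toLp 2 fun p => fderiv ℝ u x (EuclideanSpace.single p.2 1) p.1

/-! ### Sobolev spaces -/

/-- `w` is the weak partial derivative `∂_j f` in `Ω`. -/
def HasWeakPartialDeriv {F : Type*} [NormedAddCommGroup F] [NormedSpace ℝ F]
    (Ω : Opens R3) (j : Fin 3) (f w : R3 → F) : Prop :=
  ∀ φ : 𝓓(Ω, ℝ), ∫ x in (Ω : Set R3), fderiv ℝ φ x (EuclideanSpace.single j 1) • f x
    = - ∫ x in (Ω : Set R3), φ x • w x

/-- `f ∈ H¹(Ω; F)`: `f` and its weak first-order partial derivatives are square integrable. -/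
def MemH1 {F : Type*} [NormedAddCommGroup F] [NormedSpace ℝ F]
    (Ω : Opens R3) (f : R3 → F) : Prop :=
  MemLp f 2 (volume.restrict (Ω : Set R3)) ∧
    ∀ j : Fin 3, ∃ w : R3 → F,
      MemLp w 2 (volume.restrict (Ω : Set R3)) ∧ HasWeakPartialDeriv Ω j f w

/-- The Hilbert space `L²(Ω; ℝ³) × L²(Ω; ℝ^{3×3})`, with the norm
`(‖v‖² + ‖G‖²)^{1/2}`. -/
abbrev L2Pair (Ω : Opens R3) : Type :=
  WithLp 2 (Lp R3 2 (volume.restrict (Ω : Set R3)) × Lp Tensor 2 (volume.restrict (Ω : Set R3)))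

lemma jacobian_continuous {Ω : Opens R3} (φ : 𝓓(Ω, R3)) : Continuous (jacobian φ) := by
  have h : Continuous (fderiv ℝ (φ : R3 → R3)) :=
    φ.contDiff.continuous_fderiv (by simp)
  unfold jacobian
  fun_prop

lemma jacobian_hasCompactSupport {Ω : Opens R3} (φ : 𝓓(Ω, R3)) :
    HasCompactSupport (jacobian φ) := by
  refine (φ.hasCompactSupport.fderiv (𝕜 := ℝ)).mono ?_
  intro x hx h0
  apply hx
  ext p
  simp [jacobian, h0]

lemma memLp_testField {Ω : Opens R3} (φ : 𝓓(Ω, R3)) :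
    MemLp φ 2 (volume.restrict (Ω : Set R3)) :=
  (φ.continuous.memLp_of_hasCompactSupport φ.hasCompactSupport).restrict _

lemma memLp_jacobian {Ω : Opens R3} (φ : 𝓓(Ω, R3)) :
    MemLp (jacobian φ) 2 (volume.restrict (Ω : Set R3)) :=
  ((jacobian_continuous φ).memLp_of_hasCompactSupport (jacobian_hasCompactSupport φ)).restrict _

lemma jacobian_add {Ω : Opens R3} (φ ψ : 𝓓(Ω, R3)) :
    jacobian (φ + ψ : 𝓓(Ω, R3)) = jacobian φ + jacobian ψ := by
  funext x
  have h : fderiv ℝ (⇑φ + ⇑ψ) x = fderiv ℝ φ x + fderiv ℝ ψ x := by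
    exact fderiv_add (φ.contDiff.differentiable (by simp) x)
      (ψ.contDiff.differentiable (by simp) x)
  ext p
  simp [jacobian, h]

lemma jacobian_smul {Ω : Opens R3} (c : ℝ) (φ : 𝓓(Ω, R3)) :
    jacobian (c • φ : 𝓓(Ω, R3)) = c • jacobian φ := by
  funext x
  have h : fderiv ℝ (c • ⇑φ) x = c • fderiv ℝ φ x := by
    exact fderiv_const_smul (φ.contDiff.differentiable (by simp) x) c
  ext p
  simp [jacobian, h]

/-- The linear map `φ ↦ (φ, D φ)` on test vector fields. -/
def testPair (Ω : Opens R3) : 𝓓(Ω, R3) →ₗ[ℝ] L2Pair Ω where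
  toFun φ := WithLp.toLp 2 ((memLp_testField φ).toLp φ, (memLp_jacobian φ).toLp (jacobian φ))
  map_add' φ ψ := by
    rw [← WithLp.toLp_add, Prod.mk_add_mk, ← MemLp.toLp_add, ← MemLp.toLp_add]
    congr! 3
    exact jacobian_add φ ψ
  map_smul' c φ := by
    simp only [RingHom.id_apply]
    rw [← WithLp.toLp_smul, Prod.smul_mk, ← MemLp.toLp_const_smul, ← MemLp.toLp_const_smul]
    congr! 3
    exact jacobian_smul c φ

/-- The space `H¹₀(Ω; ℝ³)`, the closure of the smooth compactly supported vector fields with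
respect to the `H¹` norm. A member `v` is stored together with its weak gradient, as the pair
`(v, D v)` in `L²(Ω; ℝ³) × L²(Ω; ℝ^{3×3})`. -/
def H10 (Ω : Opens R3) : Submodule ℝ (L2Pair Ω) :=
  (LinearMap.range (testPair Ω)).topologicalClosure

/-- A test vector field as a member of `H¹₀(Ω; ℝ³)`. -/
def testToH10 {Ω : Opens R3} (φ : 𝓓(Ω, R3)) : H10 Ω :=
  ⟨testPair Ω φ, Submodule.le_topologicalClosure _ ⟨φ, rfl⟩⟩

/-- The weak gradient `D v` of `v ∈ H¹₀(Ω; ℝ³)`. -/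
def weakGrad {Ω : Opens R3} (v : H10 Ω) : R3 → Tensor := fun x => (v : L2Pair Ω).snd x

/-- The space `H⁻¹(Ω; ℝ³)`, the dual of `H¹₀(Ω; ℝ³)`. -/
abbrev Hneg1 (Ω : Opens R3) : Type := StrongDual ℝ (H10 Ω)

/-! ### The operator `v ↦ -Div [ℍ(σ).sym D v]` -/

/-- A constitutive fourth-order stiffness tensor `S ↦ ℍ(S)`: for every stress `S ∈ Sym(3)` it gives
a linear map `D ↦ ℍ(S).D` of `Sym(3)` to itself (minor symmetry). -/
abbrev StiffnessTensor : Type := Sym3 → (Sym3 →L[ℝ] Sym3)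

/-- The field `x ↦ ℍ(s(x)).sym D v(x)`. -/
def stressRate {Ω : Opens R3} (H : StiffnessTensor) (s : R3 → Sym3) (v : H10 Ω) :
    R3 → Sym3 :=
  fun x => H (s x) (symPart (weakGrad v x))

/-- `F ∈ H⁻¹(Ω; ℝ³)` is the distribution `-Div τ`, where
`(Div τ)_i = ∑_j ∂_j τ_{ij}`: the field `τ` is locally integrable in `Ω`, and
`⟨F, φ⟩ = ∫ ⟨τ, D φ⟩` for all test vector fields `φ`. -/
def IsNegDiv {Ω : Opens R3} (τ : R3 → Sym3) (F : Hneg1 Ω) : Prop :=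
  LocallyIntegrableOn τ (Ω : Set R3) ∧
    ∀ φ : 𝓓(Ω, R3),
      F (testToH10 φ) = ∫ x in (Ω : Set R3), inner ℝ (τ x : Tensor) (jacobian φ x)

/-- `-Div [ℍ(s).sym D v]` lies in `H⁻¹(Ω; ℝ³)` for every `v ∈ H¹₀(Ω; ℝ³)`. -/
def MapsToHneg1 (Ω : Opens R3) (H : StiffnessTensor) (s : R3 → Sym3) : Prop :=
  ∀ v : H10 Ω, ∃ F : Hneg1 Ω, IsNegDiv (stressRate H s v) F

/-- The operator `𝔸(s) : H¹₀(Ω; ℝ³) → H⁻¹(Ω; ℝ³)`, `v ↦ -Div [ℍ(s).sym D v]`. -/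
def stiffnessOperator {Ω : Opens R3} {H : StiffnessTensor} {s : R3 → Sym3}
    (h : MapsToHneg1 Ω H s) (v : H10 Ω) : Hneg1 Ω :=
  (h v).choose

/-- Hemicontinuity of an operator from a normed space to its dual. -/
def Hemicontinuous {V : Type*} [NormedAddCommGroup V] [NormedSpace ℝ V]
    (A : V → StrongDual ℝ V) : Prop :=
  ∀ v₁ v₂ w : V, ContinuousOn (fun r : ℝ => A ((1 - r) • v₁ + r • v₂) w) (Icc 0 1)

/-- Strict monotonicity of an operator from a normed space to its dual. -/
def StrictlyMonotone {V : Type*} [NormedAddCommGroup V] [NormedSpace ℝ V]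
    (A : V → StrongDual ℝ V) : Prop :=
  ∀ v₁ v₂ : V, v₁ ≠ v₂ → 0 < (A v₁ - A v₂) (v₁ - v₂)

/-- Uniform positive definiteness of the stiffness tensor along the stress field `s` on `Ω`:
`⟨ℍ(s(x)).D, D⟩ ≥ c₀ ‖D‖²` for all `D ∈ Sym(3)`, for almost every `x ∈ Ω`. -/
def UniformlyPosDef (Ω : Opens R3) (H : StiffnessTensor) (s : R3 → Sym3) : Prop :=
  ∃ c₀ : ℝ, 0 < c₀ ∧ ∀ᵐ x ∂(volume.restrict (Ω : Set R3)), ∀ D : Sym3,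
    c₀ * ‖D‖ ^ 2 ≤ inner ℝ (H (s x) D) D

/-- `v ∈ H¹₀(Ω; ℝ³)` solves `-Div [ℍ(s).sym D v] = g` in `Ω`, in the sense of distributions. -/
def IsSolution {Ω : Opens R3} (H : StiffnessTensor) (s : R3 → Sym3) (g : R3 → R3)
    (v : H10 Ω) : Prop :=
  LocallyIntegrableOn (stressRate H s v) (Ω : Set R3) ∧
    ∀ φ : 𝓓(Ω, R3),
      ∫ x in (Ω : Set R3), inner ℝ (stressRate H s v x : Tensor) (jacobian φ x)
        = ∫ x in (Ω : Set R3), inner ℝ (g x) (φ x)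

/-- The time interval `(0, T)`, where `0 < T ≤ ∞`. -/
def timeInterval (T : EReal) : Set ℝ := {t | 0 < t ∧ (t : EReal) < T}

end RateElasticity

end

noncomputable section

namespace RateElasticity

open Filter Topology

variable {Ω : Opens R3}

/-! The operator is linear, and a functional in `Hneg1` is determined by its values on test fields
because these are dense. Well-definedness alone makes the operator bounded, with no bound on the
stiffness, by two uses of the closed graph theorem: `continuous_pairingL1` for the pairing with one
fixed test field, then `continuous_stiffnessLinear` for the operator itself. Hemicontinuity follows.

Coercivity is checked on test fields, where the duality pairing is an actual integral: pointwise
positivity bounds it below by the symmetric gradient, `korn` passes to the full gradient and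
`poincare` to the `H¹` norm. Boundedness carries the estimate to the closure. Strict monotonicity is
then immediate, and Lax–Milgram gives bijectivity, hence unique solvability for every load in `L²`.
By Fubini, almost every time slice of the space-time load is such a load. -/

instance : CompleteSpace (H10 Ω) :=
  inferInstanceAs (CompleteSpace (LinearMap.range (testPair Ω)).topologicalClosure)

/-! ### The symmetric part -/

/-- The symmetric part as a continuous linear map. -/
def symPartL : Tensor →L[ℝ] Sym3 :=
  LinearMap.toContinuousLinearMap
    { toFun := symPart
      map_add' := by
        intro X Y
        ext p
        simp only [symPart, PiLp.add_apply, Submodule.coe_add]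
        ring
      map_smul' := by
        intro c X
        ext p
        simp only [symPart, PiLp.smul_apply, Submodule.coe_smul, smul_eq_mul, RingHom.id_apply]
        ring }

lemma symPartL_apply (X : Tensor) : symPartL X = symPart X := rfl

lemma symPart_add (X Y : Tensor) : symPart (X + Y) = symPart X + symPart Y :=
  symPartL.map_add X Y

lemma symPart_smul (c : ℝ) (X : Tensor) : symPart (c • X) = c • symPart X :=
  symPartL.map_smul c X

lemma symPart_continuous : Continuous symPart := symPartL.continuous

/-- Symmetric matrices are Frobenius-orthogonal to skew ones. -/
lemma inner_eq_inner_symPart (S : Sym3) (X : Tensor) :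
    inner ℝ (S : Tensor) X = inner ℝ S (symPart X) := by
  have hS : ∀ i j, (S : Tensor) (i, j) = (S : Tensor) (j, i) := S.2
  rw [Submodule.coe_inner]
  simp only [PiLp.inner_apply, Fintype.sum_prod_type, symPart, Fin.sum_univ_three, conj_trivial,
    RCLike.inner_apply]
  rw [hS 1 0, hS 2 0, hS 2 1]
  ring

/-! ### Density of test fields and uniqueness -/

lemma testToH10_denseRange : DenseRange (testToH10 : 𝓓(Ω, R3) → H10 Ω) := by
  rw [DenseRange, Subtype.dense_iff]
  intro x hx
  have : ((↑) '' range (testToH10 : 𝓓(Ω, R3) → H10 Ω) : Set (L2Pair Ω))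
      = (LinearMap.range (testPair Ω) : Set (L2Pair Ω)) := by
    ext y
    simp [testToH10]
  have hx' : x ∈ closure (LinearMap.range (testPair Ω) : Set (L2Pair Ω)) := hx
  exact this ▸ hx'

/-- This makes the functional chosen in `stiffnessOperator` unique, so linearity can be verified on
test fields. -/
lemma Hneg1.ext_test {F G : Hneg1 Ω} (h : ∀ φ : 𝓓(Ω, R3), F (testToH10 φ) = G (testToH10 φ)) :
    F = G := by
  apply DFunLike.coe_injective
  apply testToH10_denseRange.equalizer F.continuous G.continuous
  funext φ
  exact h φ

lemma weakGrad_add (v w : H10 Ω) :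
    weakGrad (v + w) =ᵐ[volume.restrict (Ω : Set R3)] weakGrad v + weakGrad w :=
  Lp.coeFn_add (v : L2Pair Ω).snd (w : L2Pair Ω).snd

lemma weakGrad_smul (c : ℝ) (v : H10 Ω) :
    weakGrad (c • v) =ᵐ[volume.restrict (Ω : Set R3)] c • weakGrad v :=
  Lp.coeFn_smul c (v : L2Pair Ω).snd

lemma weakGrad_testToH10 (φ : 𝓓(Ω, R3)) :
    weakGrad (testToH10 φ) =ᵐ[volume.restrict (Ω : Set R3)] jacobian φ :=
  (memLp_jacobian φ).coeFn_toLp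

variable {H : StiffnessTensor} {s : R3 → Sym3}

lemma stressRate_add (v w : H10 Ω) :
    stressRate H s (v + w) =ᵐ[volume.restrict (Ω : Set R3)]
      stressRate H s v + stressRate H s w := by
  filter_upwards [weakGrad_add v w] with x hx
  simp [stressRate, hx, symPart_add]

lemma stressRate_smul (c : ℝ) (v : H10 Ω) :
    stressRate H s (c • v) =ᵐ[volume.restrict (Ω : Set R3)] c • stressRate H s v := by
  filter_upwards [weakGrad_smul c v] with x hx
  simp [stressRate, hx, symPart_smul]

/-- The pairing of `stressRate H s v` with the gradient of a test field. -/
def pairing (H : StiffnessTensor) (s : R3 → Sym3) (φ : 𝓓(Ω, R3)) (v : H10 Ω) (x : R3) : ℝ :=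
  inner ℝ (stressRate H s v x : Tensor) (jacobian φ x)

lemma tsupport_jacobian_subset (φ : 𝓓(Ω, R3)) : tsupport (jacobian φ) ⊆ Ω := by
  refine subset_trans ?_ φ.tsupport_subset
  refine closure_minimal ?_ (isClosed_tsupport _)
  intro x hx
  by_contra h
  apply hx
  have : fderiv ℝ φ x = 0 := image_eq_zero_of_notMem_tsupport
    (fun h' => h (tsupport_fderiv_subset ℝ h'))
  ext p
  simp [jacobian, this]

/-- Local integrability is enough: the Jacobian is bounded with compact support inside `Ω`. -/
lemma integrableOn_inner_jacobian {τ : R3 → Sym3} (hτ : LocallyIntegrableOn τ (Ω : Set R3))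
    (φ : 𝓓(Ω, R3)) :
    IntegrableOn (fun x => inner ℝ (τ x : Tensor) (jacobian φ x)) (Ω : Set R3) := by
  have hK : IsCompact (tsupport (jacobian φ)) := jacobian_hasCompactSupport φ
  have h1 : IntegrableOn τ (tsupport (jacobian φ)) :=
    hτ.integrableOn_compact_subset (tsupport_jacobian_subset φ) hK
  obtain ⟨C, hC⟩ := (jacobian_continuous φ).bounded_above_of_compact_support
    (jacobian_hasCompactSupport φ)
  have h2 : IntegrableOn (fun x => inner ℝ (τ x : Tensor) (jacobian φ x))
      (tsupport (jacobian φ)) := by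
    refine Integrable.mono' (h1.norm.mul_const C) ?_ ?_
    · exact (continuous_subtype_val.comp_aestronglyMeasurable h1.aestronglyMeasurable).inner
        (jacobian_continuous φ).aestronglyMeasurable
    · refine Eventually.of_forall fun x => ?_
      exact (norm_inner_le_norm _ _).trans
        (mul_le_mul_of_nonneg_left (hC x) (norm_nonneg _))
  refine ((integrableOn_iff_integrable_of_support_subset ?_).1 h2).integrableOn
  intro x hx
  apply subset_tsupport
  intro h0
  apply hx
  simp [h0]

lemma integrable_pairing (hli : ∀ v : H10 Ω, LocallyIntegrableOn (stressRate H s v) (Ω : Set R3))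
    (φ : 𝓓(Ω, R3)) (v : H10 Ω) :
    Integrable (pairing H s φ v) (volume.restrict (Ω : Set R3)) :=
  integrableOn_inner_jacobian (hli v) φ

lemma pairing_add (φ : 𝓓(Ω, R3)) (v w : H10 Ω) :
    pairing H s φ (v + w) =ᵐ[volume.restrict (Ω : Set R3)] pairing H s φ v + pairing H s φ w := by
  filter_upwards [stressRate_add (H := H) (s := s) v w] with x hx
  simp [pairing, hx, inner_add_left]

lemma pairing_smul (φ : 𝓓(Ω, R3)) (c : ℝ) (v : H10 Ω) :
    pairing H s φ (c • v) =ᵐ[volume.restrict (Ω : Set R3)] c • pairing H s φ v := by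
  filter_upwards [stressRate_smul (H := H) (s := s) c v] with x hx
  simp [pairing, hx, inner_smul_left]

/-! ### Continuity of the operator -/

/-- Convergence in `L²` implies convergence in measure, hence almost everywhere along a subsequence.
-/
lemma tendsto_weakGrad_ae_subseq {u : ℕ → H10 Ω} {v : H10 Ω} (hu : Tendsto u atTop (𝓝 v)) :
    ∃ ns : ℕ → ℕ, StrictMono ns ∧ ∀ᵐ x ∂(volume.restrict (Ω : Set R3)),
      Tendsto (fun n => weakGrad (u (ns n)) x) atTop (𝓝 (weakGrad v x)) := by
  have h1 : Tendsto (fun n => (u n : L2Pair Ω).snd) atTop (𝓝 (v : L2Pair Ω).snd) :=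
    (((WithLp.prod_continuous_ofLp 2 _ _).snd.comp continuous_subtype_val).tendsto v).comp hu
  exact (tendstoInMeasure_of_tendsto_Lp h1).exists_seq_tendsto_ae

/-- The pairing with the gradient of a test field as a linear map to `L¹(Ω)`. -/
def pairingL1 (hli : ∀ v : H10 Ω, LocallyIntegrableOn (stressRate H s v) (Ω : Set R3))
    (φ : 𝓓(Ω, R3)) : H10 Ω →ₗ[ℝ] Lp ℝ 1 (volume.restrict (Ω : Set R3)) where
  toFun v := (integrable_pairing hli φ v).toL1 _
  map_add' v w := by
    rw [← Integrable.toL1_add, Integrable.toL1_eq_toL1_iff]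
    exact pairing_add φ v w
  map_smul' c v := by
    rw [RingHom.id_apply, ← Integrable.toL1_smul, Integrable.toL1_eq_toL1_iff]
    exact pairing_smul φ c v

/-- Closed graph: along a common subsequence both the gradients and their `L¹` images converge
almost everywhere, so the two limits agree. -/
lemma continuous_pairingL1
    (hli : ∀ v : H10 Ω, LocallyIntegrableOn (stressRate H s v) (Ω : Set R3)) (φ : 𝓓(Ω, R3)) :
    Continuous (pairingL1 hli φ) := by
  refine (pairingL1 hli φ).continuous_of_seq_closed_graph ?_
  intro u v y hu hy
  obtain ⟨ns, hns, h1⟩ := tendsto_weakGrad_ae_subseq hu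
  obtain ⟨ms, hms, h2⟩ := (tendstoInMeasure_of_tendsto_Lp
    (hy.comp hns.tendsto_atTop)).exists_seq_tendsto_ae
  have h3 : ∀ w, pairingL1 hli φ w =ᵐ[volume.restrict (Ω : Set R3)] pairing H s φ w :=
    fun w => Integrable.coeFn_toL1 (integrable_pairing hli φ w)
  have h4 : ∀ᵐ x ∂(volume.restrict (Ω : Set R3)), ∀ n,
      pairingL1 hli φ (u n) x = pairing H s φ (u n) x := ae_all_iff.2 fun n => h3 (u n)
  apply Lp.ext
  filter_upwards [h1, h2, h3 v, h4] with x h1 h2 h3 h4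
  rw [h3]
  refine tendsto_nhds_unique h2 ?_
  simp only [Function.comp_apply, h4]
  -- With `x` fixed this is a linear map on a finite-dimensional space, so no bound on the stiffness
  -- uniform in `x` is needed.
  have hc : Continuous fun X : Tensor =>
      inner ℝ (H (s x) (symPart X) : Tensor) (jacobian φ x) := by
    have := symPart_continuous
    fun_prop
  exact (hc.tendsto _).comp (h1.comp hms.tendsto_atTop)

lemma continuous_integral_pairing
    (hli : ∀ v : H10 Ω, LocallyIntegrableOn (stressRate H s v) (Ω : Set R3)) (φ : 𝓓(Ω, R3)) :
    Continuous fun v : H10 Ω => ∫ x in (Ω : Set R3), pairing H s φ v x := by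
  have h := continuous_integral.comp (continuous_pairingL1 hli φ)
  refine h.congr fun v => ?_
  exact integral_congr_ae (Integrable.coeFn_toL1 (integrable_pairing hli φ v))

lemma isNegDiv_stiffnessOperator (h : MapsToHneg1 Ω H s) (v : H10 Ω) :
    IsNegDiv (stressRate H s v) (stiffnessOperator h v) := (h v).choose_spec

lemma stiffnessOperator_apply_test (h : MapsToHneg1 Ω H s) (v : H10 Ω) (φ : 𝓓(Ω, R3)) :
    stiffnessOperator h v (testToH10 φ) = ∫ x in (Ω : Set R3), pairing H s φ v x :=
  (isNegDiv_stiffnessOperator h v).2 φ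

/-- The stiffness operator as a linear map. -/
def stiffnessLinear (h : MapsToHneg1 Ω H s) : H10 Ω →ₗ[ℝ] Hneg1 Ω where
  toFun := stiffnessOperator h
  map_add' v w := by
    refine Hneg1.ext_test fun φ => ?_
    have hli := fun v => (isNegDiv_stiffnessOperator h v).1
    rw [_root_.add_apply]
    simp only [stiffnessOperator_apply_test]
    rw [← integral_add (integrable_pairing hli φ v) (integrable_pairing hli φ w)]
    exact integral_congr_ae (pairing_add φ v w)
  map_smul' c v := by
    refine Hneg1.ext_test fun φ => ?_
    rw [_root_.smul_apply]
    simp only [stiffnessOperator_apply_test, RingHom.id_apply]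
    rw [← integral_smul]
    exact integral_congr_ae (pairing_smul φ c v)

/-- Closed graph again: a limit `F` of the images is identified by testing, since each tested value
depends continuously on `v`. -/
lemma continuous_stiffnessLinear (h : MapsToHneg1 Ω H s) : Continuous (stiffnessLinear h) := by
  refine LinearMap.continuous_of_seq_closed_graph (𝕜 := ℝ) (E := H10 Ω) (F := Hneg1 Ω)
    (stiffnessLinear h) ?_
  intro u v F hu hF
  refine Hneg1.ext_test fun φ => ?_
  have hli := fun v => (isNegDiv_stiffnessOperator h v).1
  have h1 := ((continuous_integral_pairing hli φ).tendsto v).comp hu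
  have h2 : Tendsto (fun n => stiffnessLinear h (u n) (testToH10 φ)) atTop
      (𝓝 (F (testToH10 φ))) :=
    ((ContinuousLinearMap.apply ℝ ℝ (testToH10 φ)).continuous.tendsto F).comp hF
  refine tendsto_nhds_unique h2 ?_
  change Tendsto _ _ (𝓝 (stiffnessOperator h v (testToH10 φ)))
  rw [stiffnessOperator_apply_test]
  refine h1.congr fun n => ?_
  exact (stiffnessOperator_apply_test h (u n) φ).symm

/-- The stiffness operator as a continuous linear map. -/
def stiffnessCLM (h : MapsToHneg1 Ω H s) : H10 Ω →L[ℝ] Hneg1 Ω :=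
  ⟨stiffnessLinear h, continuous_stiffnessLinear h⟩

lemma stiffnessCLM_apply (h : MapsToHneg1 Ω H s) (v : H10 Ω) :
    stiffnessCLM h v = stiffnessOperator h v := rfl

/-! ### Korn's first inequality -/

/-- Integrating by parts on each side moves the derivative off `f`; the second derivatives of `g`
commute. -/
lemma integral_fderiv_mul_fderiv_comm {f g : R3 → ℝ} (hf : ContDiff ℝ ∞ f) (hg : ContDiff ℝ ∞ g)
    (hfc : HasCompactSupport f) (v w : R3) :
    ∫ x, fderiv ℝ f x v * fderiv ℝ g x w = ∫ x, fderiv ℝ f x w * fderiv ℝ g x v := by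
  have hf' : ∀ a, Continuous fun x => fderiv ℝ f x a := fun a =>
    (hf.continuous_fderiv (by simp)).clm_apply continuous_const
  have hgc : ContDiff ℝ 2 g := contDiff_infty.1 hg 2
  have hgd : ContDiff ℝ 1 (fderiv ℝ g) := hgc.fderiv_right (by norm_num)
  have hg' : ∀ a, ContDiff ℝ 1 fun x => fderiv ℝ g x a := fun a =>
    hgd.clm_apply contDiff_const
  have hg2 : ∀ a b, Continuous fun x => fderiv ℝ (fun y => fderiv ℝ g y a) x b := fun a b =>
    ((hg' a).continuous_fderiv (by simp)).clm_apply continuous_const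
  have hfc' : ∀ a, HasCompactSupport fun x => fderiv ℝ f x a := fun a =>
    hfc.fderiv_apply (𝕜 := ℝ) a
  have key : ∀ a b, ∫ x, fderiv ℝ f x a * fderiv ℝ g x b
      = - ∫ x, f x * fderiv ℝ (fun y => fderiv ℝ g y b) x a := by
    intro a b
    rw [integral_mul_fderiv_eq_neg_fderiv_mul_of_integrable (f := f)
      (g := fun y => fderiv ℝ g y b) (v := a), neg_neg]
    · exact ((hf' a).mul (hg' b).continuous).integrable_of_hasCompactSupport (hfc' a).mul_right
    · exact (hf.continuous.mul (hg2 b a)).integrable_of_hasCompactSupport hfc.mul_right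
    · exact (hf.continuous.mul (hg' b).continuous).integrable_of_hasCompactSupport hfc.mul_right
    · exact fun x _ => hf.differentiable (by simp) x
    · exact fun x _ => (hg' b).differentiable (by simp) x
  rw [key v w, key w v]
  congr 2
  funext x
  congr 1
  have hd : DifferentiableAt ℝ (fderiv ℝ g) x := hgd.differentiable (by simp) x
  have hsymm : IsSymmSndFDerivAt ℝ g x :=
    hgc.contDiffAt.isSymmSndFDerivAt (by simp)
  rw [fderiv_clm_apply hd (differentiableAt_const _), fderiv_clm_apply hd (differentiableAt_const _)]
  simpa using hsymm.eq v w

lemma jacobian_apply (φ : 𝓓(Ω, R3)) (x : R3) (i j : Fin 3) :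
    jacobian φ x (i, j) = fderiv ℝ (fun y => φ y i) x (EuclideanSpace.single j 1) := by
  have h : HasFDerivAt (fun y => φ y i)
      ((EuclideanSpace.proj i : R3 →L[ℝ] ℝ).comp (fderiv ℝ φ x)) x :=
    (EuclideanSpace.proj i : R3 →L[ℝ] ℝ).hasFDerivAt.comp x
      (φ.contDiff.differentiable (by simp) x).hasFDerivAt
  rw [h.fderiv]
  rfl

lemma two_mul_norm_symPart_sq (X : Tensor) :
    2 * ‖symPart X‖ ^ 2 = ‖X‖ ^ 2 + ∑ i, ∑ j, X (i, j) * X (j, i) := by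
  rw [Submodule.coe_norm, EuclideanSpace.real_norm_sq_eq, EuclideanSpace.real_norm_sq_eq]
  simp only [Fintype.sum_prod_type, symPart, Fin.sum_univ_three]
  ring

lemma jacobian_eq_zero_of_notMem (φ : 𝓓(Ω, R3)) {x : R3} (hx : x ∉ Ω) : jacobian φ x = 0 :=
  image_eq_zero_of_notMem_tsupport fun h => hx (tsupport_jacobian_subset φ h)

lemma integral_jacobian_mul_comm (φ : 𝓓(Ω, R3)) (i j : Fin 3) :
    ∫ x, jacobian φ x (i, j) * jacobian φ x (j, i)
      = ∫ x, jacobian φ x (i, i) * jacobian φ x (j, j) := by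
  simp only [jacobian_apply]
  have hc : ∀ i, ContDiff ℝ ∞ fun y => φ y i := fun i =>
    (EuclideanSpace.proj i : R3 →L[ℝ] ℝ).contDiff.comp φ.contDiff
  refine integral_fderiv_mul_fderiv_comm (hc i) (hc j) ?_ _ _
  exact φ.hasCompactSupport.comp_left (g := fun y : R3 => y i) rfl

lemma continuous_jacobian_apply (φ : 𝓓(Ω, R3)) (p : Fin 3 × Fin 3) :
    Continuous fun x => jacobian φ x p :=
  (EuclideanSpace.proj p : Tensor →L[ℝ] ℝ).continuous.comp (jacobian_continuous φ)

lemma integrable_jacobian_mul (φ : 𝓓(Ω, R3)) (p q : Fin 3 × Fin 3) :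
    Integrable fun x => jacobian φ x p * jacobian φ x q := by
  have hc : Continuous fun x => jacobian φ x p * jacobian φ x q :=
    (continuous_jacobian_apply φ p).mul (continuous_jacobian_apply φ q)
  have hs : HasCompactSupport fun x => jacobian φ x p * jacobian φ x q :=
    (jacobian_hasCompactSupport φ).mono fun x hx h0 => hx (by simp [h0])
  exact hc.integrable_of_hasCompactSupport hs

lemma integral_sum_sum {α ι κ : Type*} [Fintype ι] [Fintype κ] [MeasurableSpace α]
    {μ : Measure α} {f : ι → κ → α → ℝ} (hf : ∀ i j, Integrable (f i j) μ) :
    ∫ x, ∑ i, ∑ j, f i j x ∂μ = ∑ i, ∑ j, ∫ x, f i j x ∂μ := by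
  rw [integral_finsetSum _ fun i _ => integrable_finsetSum _ fun j _ => hf i j]
  exact Finset.sum_congr rfl fun i _ => integral_finsetSum _ fun j _ => hf i j

/-- After exchanging the derivatives the integrand becomes the squared divergence. -/
lemma integral_sum_jacobian_mul_nonneg (φ : 𝓓(Ω, R3)) :
    0 ≤ ∫ x, ∑ i, ∑ j, jacobian φ x (i, j) * jacobian φ x (j, i) := by
  have h : ∫ x, ∑ i, ∑ j, jacobian φ x (i, j) * jacobian φ x (j, i)
      = ∫ x, ∑ i, ∑ j, jacobian φ x (i, i) * jacobian φ x (j, j) := by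
    rw [integral_sum_sum fun i j => integrable_jacobian_mul φ (i, j) (j, i),
      integral_sum_sum fun i j => integrable_jacobian_mul φ (i, i) (j, j)]
    exact Finset.sum_congr rfl fun i _ => Finset.sum_congr rfl fun j _ =>
      integral_jacobian_mul_comm φ i j
  rw [h]
  refine integral_nonneg fun x => ?_
  change 0 ≤ ∑ i, ∑ j, jacobian φ x (i, i) * jacobian φ x (j, j)
  rw [← Finset.sum_mul_sum]
  exact mul_self_nonneg _

lemma integrable_norm_jacobian_sq (φ : 𝓓(Ω, R3)) : Integrable fun x => ‖jacobian φ x‖ ^ 2 := by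
  refine ((jacobian_continuous φ).norm.pow 2).integrable_of_hasCompactSupport ?_
  exact (jacobian_hasCompactSupport φ).mono fun x hx h0 => hx (by simp [h0])

lemma integrable_norm_symPart_jacobian_sq (φ : 𝓓(Ω, R3)) :
    Integrable fun x => ‖symPart (jacobian φ x)‖ ^ 2 := by
  refine ((symPart_continuous.comp
    (jacobian_continuous φ)).norm.pow 2).integrable_of_hasCompactSupport ?_
  exact (jacobian_hasCompactSupport φ).mono fun x hx h0 => hx (by simp [h0, ← symPartL_apply])

/-- Korn's first inequality for test fields. -/
lemma korn (φ : 𝓓(Ω, R3)) :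
    ∫ x in (Ω : Set R3), ‖jacobian φ x‖ ^ 2
      ≤ 2 * ∫ x in (Ω : Set R3), ‖symPart (jacobian φ x)‖ ^ 2 := by
  have h0 : symPart (0 : Tensor) = 0 := symPartL.map_zero
  -- Both integrands vanish off `Ω`, so the integrals extend to the whole space, where integration
  -- by parts was done.
  rw [setIntegral_eq_integral_of_forall_compl_eq_zero
      (fun x hx => by simp [jacobian_eq_zero_of_notMem φ hx]),
    setIntegral_eq_integral_of_forall_compl_eq_zero
      (fun x hx => by simp [jacobian_eq_zero_of_notMem φ hx, h0]), ← integral_const_mul]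
  simp only [two_mul_norm_symPart_sq]
  have hint : Integrable fun x => ∑ i, ∑ j, jacobian φ x (i, j) * jacobian φ x (j, i) :=
    integrable_finsetSum _ fun i _ => integrable_finsetSum _ fun j _ =>
      integrable_jacobian_mul φ (i, j) (j, i)
  rw [integral_add (integrable_norm_jacobian_sq φ) hint]
  linarith [integral_sum_jacobian_mul_nonneg φ]

/-! ### Poincaré's inequality -/

lemma norm_fderiv_le_jacobian (φ : 𝓓(Ω, R3)) (x : R3) :
    ‖fderiv ℝ φ x‖ ≤ 3 * ‖jacobian φ x‖ := by
  have hj : ∀ j, ‖fderiv ℝ φ x (EuclideanSpace.single j 1)‖ ≤ ‖jacobian φ x‖ := by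
    intro j
    refine le_of_sq_le_sq ?_ (norm_nonneg _)
    rw [EuclideanSpace.real_norm_sq_eq, EuclideanSpace.real_norm_sq_eq, Fintype.sum_prod_type]
    refine Finset.sum_le_sum fun i _ => ?_
    exact Finset.single_le_sum (f := fun j => jacobian φ x (i, j) ^ 2)
      (fun _ _ => sq_nonneg _) (Finset.mem_univ j)
  refine ContinuousLinearMap.opNorm_le_bound _ (by positivity) fun v => ?_
  have hv : v = ∑ j, v j • (EuclideanSpace.single j 1 : R3) := by
    ext i
    simp [Pi.single_apply]
  calc ‖fderiv ℝ φ x v‖ = ‖∑ j, v j • fderiv ℝ φ x (EuclideanSpace.single j 1)‖ := by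
        conv_lhs => rw [hv]
        simp only [map_sum, map_smul]
    _ ≤ ∑ j : Fin 3, ‖v‖ * ‖jacobian φ x‖ := by
        refine norm_sum_le_of_le _ fun j _ => ?_
        rw [norm_smul]
        exact mul_le_mul (PiLp.norm_apply_le v j) (hj j) (norm_nonneg _) (norm_nonneg _)
    _ = 3 * ‖jacobian φ x‖ * ‖v‖ := by
        simp
        ring

/-- The Gagliardo–Nirenberg–Sobolev inequality for functions supported in a bounded set, with both
exponents 2: this is allowed as `2 < 3` and `1/2 - 1/3 ≤ 1/2`. The factor 3 comes from
`norm_fderiv_le_jacobian`. -/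
lemma poincare (hΩ : Bornology.IsBounded (Ω : Set R3)) :
    ∃ C : ℝ, 0 ≤ C ∧ ∀ φ : 𝓓(Ω, R3), ‖(memLp_testField φ).toLp φ‖
      ≤ C * ‖(memLp_jacobian φ).toLp (jacobian φ)‖ := by
  set K := eLpNormLESNormFDerivOfLeConst R3 (volume : Measure R3) (Ω : Set R3) 2 2
  refine ⟨K * 3, by positivity, fun φ => ?_⟩
  have h1 : eLpNorm φ 2 (volume : Measure R3) ≤ K * eLpNorm (fderiv ℝ φ) 2 volume := by
    refine eLpNorm_le_eLpNorm_fderiv_of_le (p := 2) (q := 2) volume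
      (φ.contDiff.of_le (by exact_mod_cast le_top))
      ((subset_tsupport _).trans φ.tsupport_subset) (by norm_num) (by simp; norm_num) ?_ hΩ
    simp
  have h2 : eLpNorm (fderiv ℝ φ) 2 (volume : Measure R3)
      ≤ ENNReal.ofReal 3 * eLpNorm (jacobian φ) 2 volume :=
    eLpNorm_le_mul_eLpNorm_of_ae_le_mul (Eventually.of_forall (norm_fderiv_le_jacobian φ)) _
  have h3 : eLpNorm (jacobian φ) 2 (volume.restrict (Ω : Set R3))
      = eLpNorm (jacobian φ) 2 volume :=
    eLpNorm_restrict_eq_of_support_subset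
      ((subset_tsupport _).trans (tsupport_jacobian_subset φ))
  have h4 : eLpNorm φ 2 (volume.restrict (Ω : Set R3))
      ≤ K * (ENNReal.ofReal 3 * eLpNorm (jacobian φ) 2 (volume.restrict (Ω : Set R3))) := by
    rw [h3]
    exact (eLpNorm_restrict_le _ _ _ _).trans (h1.trans (mul_le_mul_right h2 _))
  rw [Lp.norm_toLp, Lp.norm_toLp]
  have hfin := (memLp_jacobian φ).eLpNorm_ne_top
  have h5 := ENNReal.toReal_mono (by finiteness) h4
  rw [ENNReal.toReal_mul, ENNReal.toReal_mul, ENNReal.toReal_ofReal (by norm_num)] at h5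
  rw [mul_assoc]
  exact h5

/-! ### Coercivity and the Lax–Milgram theorem -/

lemma norm_toLp_sq {F : Type*} [NormedAddCommGroup F] [InnerProductSpace ℝ F] {α : Type*}
    [MeasurableSpace α] {μ : Measure α} {f : α → F} (hf : MemLp f 2 μ) :
    ‖hf.toLp f‖ ^ 2 = ∫ x, ‖f x‖ ^ 2 ∂μ := by
  rw [← real_inner_self_eq_norm_sq, L2.inner_def]
  refine integral_congr_ae ?_
  filter_upwards [hf.coeFn_toLp] with x hx
  rw [hx, real_inner_self_eq_norm_sq]

lemma norm_testToH10_sq (φ : 𝓓(Ω, R3)) :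
    ‖testToH10 φ‖ ^ 2 = ‖(memLp_testField φ).toLp φ‖ ^ 2
      + ‖(memLp_jacobian φ).toLp (jacobian φ)‖ ^ 2 :=
  WithLp.prod_norm_sq_eq_of_L2 _

lemma le_stiffnessOperator_test (h : MapsToHneg1 Ω H s) {c₀ : ℝ}
    (hpos : ∀ᵐ x ∂(volume.restrict (Ω : Set R3)), ∀ D : Sym3,
      c₀ * ‖D‖ ^ 2 ≤ inner ℝ (H (s x) D) D) (φ : 𝓓(Ω, R3)) :
    c₀ * ∫ x in (Ω : Set R3), ‖symPart (jacobian φ x)‖ ^ 2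
      ≤ stiffnessOperator h (testToH10 φ) (testToH10 φ) := by
  rw [stiffnessOperator_apply_test, ← integral_const_mul]
  refine integral_mono_ae ((integrable_norm_symPart_jacobian_sq φ).integrableOn.const_mul c₀)
    (integrable_pairing (fun v => (isNegDiv_stiffnessOperator h v).1) φ _) ?_
  filter_upwards [hpos, weakGrad_testToH10 φ] with x hx hw
  simp only [pairing, stressRate]
  rw [hw, inner_eq_inner_symPart]
  exact hx _

lemma isCoercive_stiffnessCLM (hΩ : Bornology.IsBounded (Ω : Set R3))
    (hpos : UniformlyPosDef Ω H s) (h : MapsToHneg1 Ω H s) : IsCoercive (stiffnessCLM h) := by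
  obtain ⟨c₀, hc₀, hpos⟩ := hpos
  obtain ⟨C, hC0, hC⟩ := poincare hΩ
  -- Poincaré contributes `C ^ 2 + 1`, Korn the factor 2.
  refine ⟨c₀ / (2 * (C ^ 2 + 1)), by positivity, fun v => ?_⟩
  -- Closedness rests on the continuity obtained from the closed graph theorem.
  have hclosed : IsClosed {v : H10 Ω |
      c₀ / (2 * (C ^ 2 + 1)) * ‖v‖ * ‖v‖ ≤ stiffnessCLM h v v} :=
    isClosed_le (by fun_prop) (by fun_prop)
  refine testToH10_denseRange.induction_on (p := fun v : H10 Ω =>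
      c₀ / (2 * (C ^ 2 + 1)) * ‖v‖ * ‖v‖ ≤ stiffnessCLM h v v) v hclosed fun φ => ?_
  have h1 := le_stiffnessOperator_test h hpos φ
  have h2 := korn φ
  have h3 := norm_testToH10_sq φ
  have h4 : ‖(memLp_testField φ).toLp φ‖ ^ 2
      ≤ C ^ 2 * ‖(memLp_jacobian φ).toLp (jacobian φ)‖ ^ 2 := by
    rw [← mul_pow]
    exact pow_le_pow_left₀ (norm_nonneg _) (hC φ) 2
  rw [← norm_toLp_sq (memLp_jacobian φ)] at h2
  rw [stiffnessCLM_apply]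
  refine le_trans ?_ h1
  rw [mul_assoc, ← sq, div_mul_eq_mul_div, div_le_iff₀ (by positivity), mul_assoc]
  refine mul_le_mul_of_nonneg_left ?_ hc₀.le
  calc _ ≤ (C ^ 2 + 1) * ‖(memLp_jacobian φ).toLp (jacobian φ)‖ ^ 2 := by linarith
    _ ≤ (C ^ 2 + 1) * (2 * ∫ x in (Ω : Set R3), ‖symPart (jacobian φ x)‖ ^ 2) :=
        mul_le_mul_of_nonneg_left h2 (by positivity)
    _ = _ := by ring

lemma hemicontinuous_stiffnessOperator (h : MapsToHneg1 Ω H s) :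
    Hemicontinuous (stiffnessOperator h) := by
  intro v₁ v₂ w
  have : Continuous fun r : ℝ => stiffnessCLM h ((1 - r) • v₁ + r • v₂) w := by fun_prop
  exact this.continuousOn

lemma strictlyMonotone_of_isCoercive {V : Type*} [NormedAddCommGroup V] [InnerProductSpace ℝ V]
    {B : V →L[ℝ] V →L[ℝ] ℝ} (hB : IsCoercive B) : StrictlyMonotone (fun v => B v) := by
  intro v₁ v₂ hne
  obtain ⟨c, hc, hcoer⟩ := hB
  have hpos : 0 < ‖v₁ - v₂‖ := norm_pos_iff.2 (sub_ne_zero.2 hne)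
  rw [← map_sub]
  exact lt_of_lt_of_le (mul_pos (mul_pos hc hpos) hpos) (hcoer (v₁ - v₂))

/-- Lax–Milgram represents the form by an isomorphism of `V`; the Riesz map then identifies `V` with
its dual. -/
lemma bijective_of_isCoercive {V : Type*} [NormedAddCommGroup V] [InnerProductSpace ℝ V]
    [CompleteSpace V] {B : V →L[ℝ] V →L[ℝ] ℝ} (hB : IsCoercive B) :
    Function.Bijective (fun v => B v) := by
  have heq : (fun v => B v)
      = InnerProductSpace.toDual ℝ V ∘ hB.continuousLinearEquivOfBilin := by
    funext v
    ext w
    simp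
  rw [heq]
  exact (InnerProductSpace.toDual ℝ V).bijective.comp hB.continuousLinearEquivOfBilin.bijective

lemma strictlyMonotone_stiffnessOperator (hΩ : Bornology.IsBounded (Ω : Set R3))
    (hpos : UniformlyPosDef Ω H s) (h : MapsToHneg1 Ω H s) :
    StrictlyMonotone (stiffnessOperator h) :=
  strictlyMonotone_of_isCoercive (isCoercive_stiffnessCLM hΩ hpos h)

lemma bijective_stiffnessOperator (hΩ : Bornology.IsBounded (Ω : Set R3))
    (hpos : UniformlyPosDef Ω H s) (h : MapsToHneg1 Ω H s) :
    Function.Bijective (stiffnessOperator h) :=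
  bijective_of_isCoercive (isCoercive_stiffnessCLM hΩ hpos h)

/-! ### Essentially bounded stiffness -/

lemma memLp_weakGrad (v : H10 Ω) : MemLp (weakGrad v) 2 (volume.restrict (Ω : Set R3)) :=
  Lp.memLp (v : L2Pair Ω).snd

lemma aestronglyMeasurable_stressRate (hH : Measurable H)
    (hs : AEStronglyMeasurable s (volume.restrict (Ω : Set R3))) (v : H10 Ω) :
    AEStronglyMeasurable (stressRate H s v) (volume.restrict (Ω : Set R3)) := by
  have h1 : AEMeasurable (fun x => H (s x)) (volume.restrict (Ω : Set R3)) :=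
    hH.comp_aemeasurable hs.aemeasurable
  have h2 : AEStronglyMeasurable (fun x => symPart (weakGrad v x))
      (volume.restrict (Ω : Set R3)) :=
    symPart_continuous.comp_aestronglyMeasurable (memLp_weakGrad v).1
  exact (isBoundedBilinearMap_apply (𝕜 := ℝ) (E := Sym3) (F := Sym3)).continuous
    |>.comp_aestronglyMeasurable (h1.aestronglyMeasurable.prodMk h2)

lemma memLp_stressRate (hH : Measurable H)
    (hs : AEStronglyMeasurable s (volume.restrict (Ω : Set R3)))
    (hM : ∃ M : ℝ, ∀ᵐ x ∂(volume.restrict (Ω : Set R3)), ‖H (s x)‖ ≤ M) (v : H10 Ω) :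
    MemLp (stressRate H s v) 2 (volume.restrict (Ω : Set R3)) := by
  obtain ⟨M, hM⟩ := hM
  refine (memLp_weakGrad v).of_le_mul (c := M * ‖symPartL‖)
    (aestronglyMeasurable_stressRate hH hs v) ?_
  filter_upwards [hM] with x hx
  rw [mul_assoc]
  exact (H (s x)).le_of_opNorm_le_of_le hx (symPartL.le_opNorm _)

lemma mapsToHneg1_of_bounded (hΩ : Bornology.IsBounded (Ω : Set R3)) (hH : Measurable H)
    (hs : AEStronglyMeasurable s (volume.restrict (Ω : Set R3)))
    (hM : ∃ M : ℝ, ∀ᵐ x ∂(volume.restrict (Ω : Set R3)), ‖H (s x)‖ ≤ M) :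
    MapsToHneg1 Ω H s := by
  intro v
  have : IsFiniteMeasure (volume.restrict (Ω : Set R3)) :=
    isFiniteMeasure_restrict.2 hΩ.measure_lt_top.ne
  have hτ := memLp_stressRate hH hs hM v
  have hτ' : MemLp (fun x => (stressRate H s v x : Tensor)) 2 (volume.restrict (Ω : Set R3)) :=
    Sym3.subtypeL.comp_memLp' hτ
  -- The functional is `w ↦ ⟨τ, D w⟩` in `L²`, bounded by Cauchy–Schwarz.
  refine ⟨(innerSL ℝ (hτ'.toLp _)).comp
    ((WithLp.sndL 2 ℝ _ _).comp (H10 Ω).subtypeL), ?_, ?_⟩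
  -- On a set of finite measure, `L²` is contained in `L¹`.
  · have h1 : IntegrableOn (stressRate H s v) (Ω : Set R3) := hτ.integrable (by norm_num)
    exact h1.locallyIntegrableOn
  · intro φ
    change inner ℝ (hτ'.toLp _) ((memLp_jacobian φ).toLp (jacobian φ)) = _
    rw [L2.inner_def]
    refine integral_congr_ae ?_
    filter_upwards [hτ'.coeFn_toLp, (memLp_jacobian φ).coeFn_toLp] with x h1 h2
    rw [h1, h2]

/-! ### Square integrable loads -/

lemma exists_Hneg1_of_memLp {g : R3 → R3} (hg : MemLp g 2 (volume.restrict (Ω : Set R3))) :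
    ∃ F : Hneg1 Ω, ∀ φ : 𝓓(Ω, R3),
      F (testToH10 φ) = ∫ x in (Ω : Set R3), inner ℝ (g x) (φ x) := by
  refine ⟨(innerSL ℝ (hg.toLp _)).comp
    ((WithLp.fstL 2 ℝ _ _).comp (H10 Ω).subtypeL), fun φ => ?_⟩
  change inner ℝ (hg.toLp _) ((memLp_testField φ).toLp φ) = _
  rw [L2.inner_def]
  refine integral_congr_ae ?_
  filter_upwards [hg.coeFn_toLp, (memLp_testField φ).coeFn_toLp] with x h1 h2
  rw [h1, h2]

lemma isSolution_iff (h : MapsToHneg1 Ω H s) {g : R3 → R3} {F : Hneg1 Ω}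
    (hF : ∀ φ : 𝓓(Ω, R3), F (testToH10 φ) = ∫ x in (Ω : Set R3), inner ℝ (g x) (φ x))
    (v : H10 Ω) : IsSolution H s g v ↔ stiffnessOperator h v = F := by
  constructor
  · intro hv
    refine Hneg1.ext_test fun φ => ?_
    rw [stiffnessOperator_apply_test, hF]
    exact hv.2 φ
  · intro hv
    refine ⟨(isNegDiv_stiffnessOperator h v).1, fun φ => ?_⟩
    rw [← hF, ← hv, stiffnessOperator_apply_test]
    rfl

lemma existsUnique_isSolution (hΩ : Bornology.IsBounded (Ω : Set R3))
    (hpos : UniformlyPosDef Ω H s) (h : MapsToHneg1 Ω H s) {g : R3 → R3}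
    (hg : MemLp g 2 (volume.restrict (Ω : Set R3))) : ∃! v : H10 Ω, IsSolution H s g v := by
  obtain ⟨F, hF⟩ := exists_Hneg1_of_memLp hg
  simp only [isSolution_iff h hF]
  exact (bijective_stiffnessOperator hΩ hpos h).existsUnique F

/-- Fubini applied to the integrable function `‖g‖ ^ 2`. -/
lemma memLp_ae_slice {α β E : Type*} [MeasurableSpace α] [MeasurableSpace β]
    [NormedAddCommGroup E] {μ : Measure α} {ν : Measure β} [SFinite μ] [SFinite ν]
    {g : α × β → E} (hg : MemLp g 2 (μ.prod ν)) :
    ∀ᵐ t ∂ν, MemLp (fun x => g (x, t)) 2 μ := by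
  have h1 : ∀ᵐ t ∂ν, AEStronglyMeasurable (fun x => g (x, t)) μ := hg.1.prod_swap.prodMk_left
  have h2 := ((memLp_two_iff_integrable_sq_norm hg.1).1 hg).prod_left_ae
  filter_upwards [h1, h2] with t h1 h2
  exact (memLp_two_iff_integrable_sq_norm h1).2 h2

end RateElasticity

end
open RateElasticity in
theorem mainTheorem1
    (Ω : Opens R3) (hΩ : Bornology.IsBounded (Ω : Set R3))
    (T : EReal) (hT : 0 < T)
    (H : StiffnessTensor) (hH : Measurable H)
    (σ : R3 → ℝ → Sym3) :
    -- if `ℍ(σ(·,t))` is essentially bounded, the operator maps `H¹₀` into `H⁻¹`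
    (∀ t ∈ timeInterval T, MemH1 Ω (fun x => σ x t) →
      (∃ M : ℝ, ∀ᵐ x ∂(volume.restrict (Ω : Set R3)), ‖H (σ x t)‖ ≤ M) →
      MapsToHneg1 Ω H (fun x => σ x t)) ∧
    -- hemicontinuity and strict monotonicity
    (∀ t ∈ timeInterval T, MemH1 Ω (fun x => σ x t) →
      UniformlyPosDef Ω H (fun x => σ x t) →
      ∀ h : MapsToHneg1 Ω H (fun x => σ x t),
        Hemicontinuous (stiffnessOperator h) ∧ StrictlyMonotone (stiffnessOperator h)) ∧
    -- existence and uniqueness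
    (∀ g : R3 × ℝ → R3, MemLp g 2 (volume.restrict ((Ω : Set R3) ×ˢ timeInterval T)) →
      ∀ᵐ t ∂(volume.restrict (timeInterval T)), MemH1 Ω (fun x => σ x t) →
        UniformlyPosDef Ω H (fun x => σ x t) → MapsToHneg1 Ω H (fun x => σ x t) →
        ∃! v : H10 Ω, IsSolution H (fun x => σ x t) (fun x => g (x, t)) v) := by

  refine ⟨fun t _ hs hM => mapsToHneg1_of_bounded hΩ hH hs.1.1 hM,
    fun t _ _ hpos h => ⟨hemicontinuous_stiffnessOperator h,
      strictlyMonotone_stiffnessOperator hΩ hpos h⟩, fun g hg => ?_⟩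
  rw [Measure.volume_eq_prod, ← Measure.prod_restrict] at hg
  filter_upwards [memLp_ae_slice hg] with t ht _ hpos h
  exact existsUnique_isSolution hΩ hpos h ht
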